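/- For a permutation $\psi$ of a nonempty finite set $X$, let $\Lambda(\psi)$ be the largest length of a cycle of $\psi$ (fixed points being cycles of length $1$) in its decomposition into disjoint cycles. For a finite group $G$, set $\Lambda(G):=\max_{\alpha\in\mathrm{Aut}(G)}\Lambda(\alpha)$ and $\lambda(G):=\Lambda(G)/|G|$. Theorem. Let $p$ be a prime and let $G$ be a finite abelian $p$-group such that $\lambda(G)\geq\frac{1}{2}$. Then at least one of the following holds: $G$ is elementary abelian, i.e. $G\cong(\mathbb{Z}/p\mathbb{Z})^k$ for some integer $k\geq 0$; or $G$ is cyclic (of $p$-power order); or $G\cong\mathbb{Z}/2\mathbb{Z}\times\mathbb{Z}/4\mathbb{Z}$. -/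

import Mathlib

/-- The length of the cycle of the permutation `ψ` through `x`, that is, the number of points on
that cycle. A fixed point lies on a cycle of length `1`. -/
noncomputable def cycleLength {X : Type*} (ψ : Equiv.Perm X) (x : X) : ℕ :=
  Set.ncard {y : X | ψ.SameCycle x y}

/-- `Λ(ψ)` for a permutation `ψ` of a finite set: the largest length of one of the disjoint cycles
(cycles of length `1` included) into which `ψ` decomposes. -/
noncomputable def bigLambdaPerm {X : Type*} (ψ : Equiv.Perm X) : ℕ :=
  ⨆ x : X, cycleLength ψ x

/-- `λ(ψ) = Λ(ψ) / |X|` for a permutation `ψ` of a finite set `X`. -/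
noncomputable def lambdaPerm {X : Type*} (ψ : Equiv.Perm X) : ℚ :=
  (bigLambdaPerm ψ : ℚ) / (Nat.card X : ℚ)

/-- `Λ(G)` for a finite group `G`: the maximum of `Λ(α)` over all automorphisms `α` of `G`. -/
noncomputable def bigLambdaGroup (G : Type*) [Group G] : ℕ :=
  ⨆ α : MulAut G, bigLambdaPerm (MulAut.toPerm G α)

/-- `λ(G) = Λ(G) / |G|` for a finite group `G`. -/
noncomputable def lambdaGroup (G : Type*) [Group G] : ℚ :=
  (bigLambdaGroup G : ℚ) / (Nat.card G : ℚ)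

/-- `G` is an elementary abelian `p`-group of finite rank: it is isomorphic to the direct product
of `k` copies of `ℤ/pℤ` for some `k ≥ 0` (the trivial group is included). -/
def IsElemAbelian (p : ℕ) (G : Type*) [Group G] : Prop :=
  ∃ k : ℕ, Nonempty (G ≃* Multiplicative (Fin k → ZMod p))

/-- On a nonempty finite set the supremum in the definition of `Λ(ψ)` is a maximum. -/
theorem bigLambdaPerm_isGreatest {X : Type*} [Finite X] [Nonempty X] (ψ : Equiv.Perm X) :
    IsGreatest (Set.range (cycleLength ψ)) (bigLambdaPerm ψ) :=
  ⟨Nat.sSup_mem (Set.range_nonempty _) (Set.finite_range _).bddAbove,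
    fun _ h => le_csSup (Set.finite_range _).bddAbove h⟩

/-- For a finite group the supremum in the definition of `Λ(G)` is a maximum. -/
theorem bigLambdaGroup_isGreatest (G : Type*) [Group G] [Finite G] :
    IsGreatest (Set.range fun α : MulAut G => bigLambdaPerm (MulAut.toPerm G α))
      (bigLambdaGroup G) :=
  have : Finite (MulAut G) := Finite.of_injective (fun α : MulAut G => (α : G → G))
    DFunLike.coe_injective
  ⟨Nat.sSup_mem (Set.range_nonempty _) (Set.finite_range _).bddAbove,
    fun _ h => le_csSup (Set.finite_range _).bddAbove h⟩

/-! Write the group additively as `A`, with an automorphism `τ` whose orbit of `x ≠ 0` covers half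
of `A`. Evaluation at `x` identifies the commutative ring `ℤ[τ]` with `A`, and counting shows that
`τ` generates its unit group (`exists_commRing_of_large_cycle`). What remains is to classify finite
rings with such cyclic units. If `p ≠ 0` in the ring, the last nonzero power `s` of `p` satisfies `s
^ 2 = 0` and `p * s = 0`, so `1 + s` generates the `p`-th roots of unity; this uniqueness constrains
the `p`-torsion. For odd `p` the torsion is `ℤ s`, so `1` generates additively. For `p = 2` it
forces `4 = 0` and, with the size of the unit group, order at most 8. -/

/-! ### Finite monoids and cyclic groups -/

/-- In a finite monoid every element has an idempotent power. -/
theorem exists_pow_mul_self_eq {M : Type*} [Monoid M] [Finite M] (y : M) :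
    ∃ n : ℕ, 0 < n ∧ y ^ n * y ^ n = y ^ n := by
  obtain ⟨i, j, hij, h⟩ := Finite.exists_ne_map_eq_of_infinite (fun n : ℕ => y ^ n)
  wlog hlt : i < j generalizing i j
  · exact this j i hij.symm h.symm (by omega)
  obtain ⟨d, rfl⟩ := Nat.exists_eq_add_of_lt hlt
  have h : y ^ i = y ^ (i + d + 1) := h
  have step : ∀ m, i ≤ m → y ^ (m + (d + 1)) = y ^ m := by
    intro m hm
    obtain ⟨t, rfl⟩ := Nat.exists_eq_add_of_le hm
    rw [show i + t + (d + 1) = (i + d + 1) + t by ring, pow_add, ← h, ← pow_add]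
  have iter : ∀ k m, i ≤ m → y ^ (m + k * (d + 1)) = y ^ m := by
    intro k m hm
    induction k with
    | zero => simp
    | succ k ih =>
      rw [show m + (k + 1) * (d + 1) = m + k * (d + 1) + (d + 1) by ring, step _ (by omega), ih]
  -- A multiple of the period `d + 1` that lies beyond the preperiod `i`.
  refine ⟨(i + 1) * (d + 1), by positivity, ?_⟩
  rw [← pow_add]
  exact iter (i + 1) _ (by nlinarith)

/-- In a finite cyclic group, the solutions of `b ^ n = 1` are the powers of any element of
order `n`. -/
theorem exists_pow_eq_of_isCyclic {U : Type*} [Group U] [Finite U] [IsCyclic U] {n : ℕ}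
    (hn : 0 < n) {a b : U} (ha : orderOf a = n) (hb : b ^ n = 1) : ∃ c : ℕ, a ^ c = b := by
  classical
  have := Fintype.ofFinite U
  have hsub : (Finset.univ.filter fun g : U => g ∈ Subgroup.zpowers a) ⊆
      Finset.univ.filter fun g : U => g ^ n = 1 := by
    intro g hg
    simp only [Finset.mem_filter, Finset.mem_univ, true_and] at hg ⊢
    obtain ⟨c, rfl⟩ := Subgroup.mem_zpowers_iff.1 hg
    rw [← zpow_natCast, ← zpow_mul, mul_comm, zpow_mul, zpow_natCast, ← ha, pow_orderOf_eq_one,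
      one_zpow]
  have hcard : (Finset.univ.filter fun g : U => g ∈ Subgroup.zpowers a).card = n := by
    rw [← ha, ← Nat.card_zpowers, ← Fintype.card_subtype, Nat.card_eq_fintype_card]
  have heq := Finset.eq_of_subset_of_card_le hsub
    (by rw [hcard]; exact IsCyclic.card_pow_eq_one_le hn)
  have hb' : b ∈ Finset.univ.filter fun g : U => g ^ n = 1 := by simp [hb]
  rw [← heq] at hb'
  simp only [Finset.mem_filter, Finset.mem_univ, true_and] at hb'
  exact (mem_powers_iff_mem_zpowers.2 hb')

theorem one_add_pow_of_sq_eq_zero {R : Type*} [CommRing R] {s : R} (hs : s ^ 2 = 0) (c : ℕ) :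
    (1 + s) ^ c = 1 + c * s := by
  induction c with
  | zero => simp
  | succ c ih =>
    rw [pow_succ, ih]
    push_cast
    linear_combination (c : R) * hs

/-! ### Roots of unity and nilpotents when the units are cyclic -/

section CyclicUnits

variable {R : Type*} [CommRing R] [Finite R] [IsCyclic Rˣ]

/-- Since `(1 + s) ^ c = 1 + c * s`, the unit `1 + s` has order `p`; cyclicity makes `1 + y` one of
its powers. -/
theorem exists_natCast_mul_eq_of_one_add_pow {p : ℕ} (hp : p.Prime) {s y : R} (hs0 : s ≠ 0)
    (hs : s ^ 2 = 0) (hps : (p : R) * s = 0) (hy : (1 + y) ^ p = 1) : ∃ c : ℕ, y = c * s := by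
  have hs1 : (1 + s) ^ p = 1 := by rw [one_add_pow_of_sq_eq_zero hs, hps, add_zero]
  let a : Rˣ := Units.ofPowEqOne _ p hs1 hp.ne_zero
  let b : Rˣ := Units.ofPowEqOne _ p hy hp.ne_zero
  have ha : orderOf a = p := by
    have := Fact.mk hp
    refine orderOf_eq_prime (Units.ext (by simp [a])) fun h => hs0 ?_
    simpa [a] using congrArg Units.val h
  obtain ⟨c, hc⟩ := exists_pow_eq_of_isCyclic hp.pos ha
    (b := b) (Units.ext (by simp [b]))
  refine ⟨c, ?_⟩
  have h := congrArg Units.val hc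
  simp only [Units.val_pow_eq_pow_val, a, b, Units.val_ofPowEqOne,
    one_add_pow_of_sq_eq_zero hs] at h
  exact (add_left_cancel h).symm

theorem exists_natCast_mul_eq_of_pow_eq_zero {p : ℕ} (hp : p.Prime) {s y : R} (hs0 : s ≠ 0)
    (hs : s ^ 2 = 0) (hps : (p : R) * s = 0) (hpy : (p : R) * y = 0) (hy : y ^ p = 0) :
    ∃ c : ℕ, y = c * s := by
  refine exists_natCast_mul_eq_of_one_add_pow hp hs0 hs hps ?_
  obtain ⟨r, hr⟩ := exists_add_pow_prime_eq hp y (1 : R)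
  rw [add_comm, hr, hy, hpy]
  simp

/-- A nilpotent element killed by an odd prime `p` is a multiple of `s`. -/
theorem exists_natCast_mul_eq_of_isNilpotent {p : ℕ} (hp : p.Prime) (hp2 : p ≠ 2) {s : R}
    (hs0 : s ≠ 0) (hs : s ^ 2 = 0) (hps : (p : R) * s = 0) (hsp : ∀ y : R, (p : R) * y = 0 →
      s * y = 0) (j : ℕ) :
    ∀ y : R, (p : R) * y = 0 → y ^ p ^ j = 0 → ∃ c : ℕ, y = c * s := by
  have hp3 : 3 ≤ p := by have := hp.two_le; omega
  induction j with
  | zero => intro y _ h; exact ⟨0, by simpa using h⟩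
  | succ j ih =>
    intro y hpy h
    obtain ⟨c, hc⟩ := ih (y ^ p) (by
      rw [show p = (p - 1) + 1 by omega, pow_succ', ← mul_assoc, ← show p = (p - 1) + 1 by omega,
        hpy, zero_mul])
      (by rw [← pow_mul, ← pow_succ', h])
    have hp1 : y ^ (p + 1) = 0 := by rw [pow_succ, hc, mul_assoc, hsp y hpy, mul_zero]
    -- Here `p * (p - 1) ≥ p + 1`, which needs `p ≥ 3`. So `y ^ (p - 1)` lies in `ℤ s`, and `s * y =
    -- 0` then gives `y ^ p = 0`.
    obtain ⟨c', hc'⟩ := exists_natCast_mul_eq_of_pow_eq_zero hp hs0 hs hps (y := y ^ (p - 1))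
      (by rw [show p - 1 = (p - 2) + 1 by omega, pow_succ', ← mul_assoc, hpy, zero_mul])
      (by
        rw [← pow_mul]
        refine pow_eq_zero_of_le ?_ hp1
        obtain ⟨q, rfl⟩ := Nat.exists_eq_add_of_le hp3
        rw [show 3 + q - 1 = 2 + q by omega]
        nlinarith)
    refine exists_natCast_mul_eq_of_pow_eq_zero hp hs0 hs hps hpy ?_
    rw [← Nat.sub_add_cancel hp.one_le, pow_succ, hc', mul_assoc, hsp y hpy, mul_zero]

/-- If `1` is not of additive order `p` and the `p`-torsion consists of multiples of `p ^ k`, then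
`R` is additively generated by `1`. -/
theorem exists_intCast_eq_of_torsion {R : Type*} [CommRing R] {p k n : ℕ} (hp : p.Prime)
    (hk : (p : R) ^ (k + 1) ≠ 0) (hk' : (p : R) ^ (k + 2) = 0) (hn : (p : R) ^ n = 0)
    (htor : ∀ y : R, (p : R) * y = 0 → ∃ c : ℕ, y = c * (p : R) ^ (k + 1)) (r : R) :
    ∃ z : ℤ, r = z := by
  have key : ∀ j : ℕ, ∀ r : R, (p : R) ^ j * r = 0 → ∃ z : ℤ, r = z := by
    intro j
    induction j with
    | zero => intro r h; exact ⟨0, by simpa using h⟩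
    | succ j ih =>
      intro r h
      obtain ⟨z, hz⟩ := ih (p * r) (by rw [← mul_assoc, ← pow_succ, h])
      -- If `a * p + b * z = 1`, multiplying by `p ^ (k + 1)` and using `z = p * r` makes `p ^ (k +
      -- 1)` vanish.
      have hpz : (p : ℤ) ∣ z := by
        by_contra hndvd
        have hcop := ((Nat.prime_iff_prime_int.1 hp).coprime_iff_not_dvd).2 hndvd
        obtain ⟨a, b, hab⟩ := hcop
        have hab' := congrArg (fun t : ℤ => (t : R)) hab
        push_cast at hab'
        apply hk
        linear_combination (-(p : R) ^ (k + 1)) * hab' + (a + b * r) * hk' -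
          (p : R) ^ (k + 1) * b * hz
      obtain ⟨w, rfl⟩ := hpz
      obtain ⟨c, hc⟩ := htor (r - w) (by push_cast at hz; linear_combination hz)
      exact ⟨w + c * p ^ (k + 1), by push_cast; linear_combination hc⟩
  exact key n r (by rw [hn, zero_mul])

/-! ### Odd characteristic -/

/-- An idempotent `e` gives a square root of unity `1 - 2 * e`, which must be `1` or `-1`, so `e` is
`0` or `1`. An idempotent power of a `p`-torsion element is not `1`, so such elements are nilpotent.
-/
theorem exists_intCast_eq_of_odd {p k : ℕ} (hp : p.Prime) (hp2 : p ≠ 2)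
    (hk : (p : R) ^ (k + 1) ≠ 0) (hk' : (p : R) ^ (k + 2) = 0) (r : R) : ∃ z : ℤ, r = z := by
  have hs2 : ((p : R) ^ (k + 1)) ^ 2 = 0 := by
    rw [← pow_mul]; exact pow_eq_zero_of_le (by omega) hk'
  have hps : (p : R) * p ^ (k + 1) = 0 := by rw [← pow_succ', hk']
  have hsp : ∀ y : R, (p : R) * y = 0 → (p : R) ^ (k + 1) * y = 0 := fun y hy => by
    rw [pow_succ, mul_assoc, hy, mul_zero]
  have hp0 : (p : R) ≠ 0 := fun h => hk (by rw [h, zero_pow (by omega)])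
  have htwo : ∀ y : R, 2 * y = 0 → y = 0 := by
    intro y hy
    have hcop : IsCoprime (2 : ℤ) ((p : ℤ) ^ (k + 2)) := by
      apply IsCoprime.pow_right
      exact_mod_cast Nat.isCoprime_iff_coprime.2
        ((Nat.coprime_primes Nat.prime_two hp).2 hp2.symm)
    obtain ⟨a, b, hab⟩ := hcop
    have hab' := congrArg (fun t : ℤ => (t : R)) hab
    push_cast at hab'
    linear_combination (-y) * hab' + a * hy + y * b * hk'
  refine exists_intCast_eq_of_torsion hp hk hk' hk' (fun y hy => ?_) r
  obtain ⟨n, hn, he⟩ := exists_pow_mul_self_eq y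
  have hpe : (p : R) * y ^ n = 0 := by
    rw [← Nat.sub_add_cancel hn, pow_succ', ← mul_assoc, hy, zero_mul]
  have hyn : y ^ n = 0 := by
    have h1 : (1 + -2 : R) ^ 2 = 1 := by ring
    have h2 : (1 + -2 * y ^ n : R) ^ 2 = 1 := by linear_combination 4 * he
    let a : Rˣ := Units.ofPowEqOne _ 2 h1 two_ne_zero
    let b : Rˣ := Units.ofPowEqOne _ 2 h2 two_ne_zero
    have ha : orderOf a = 2 := by
      refine orderOf_eq_prime (Units.ext (by simp [a])) fun h => hp0 ?_
      have h3 : (-2 : R) = 0 := by simpa [a] using congrArg Units.val h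
      have h4 := htwo 1 (by linear_combination -h3)
      linear_combination (p : R) * h4
    obtain ⟨c, hc⟩ := exists_pow_eq_of_isCyclic two_pos ha
      (b := b) (Units.ext (by simp [b]))
    have h := congrArg Units.val hc
    simp only [Units.val_pow_eq_pow_val, a, b, Units.val_ofPowEqOne] at h
    rcases Nat.even_or_odd c with hc | hc
    · obtain ⟨d, rfl⟩ := hc
      rw [← two_mul, pow_mul, h1, one_pow] at h
      exact htwo _ (by linear_combination h)
    · obtain ⟨d, rfl⟩ := hc
      rw [pow_succ, pow_mul, h1, one_pow] at h
      have h5 : 1 - y ^ n = 0 := htwo _ (by linear_combination -h)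
      exact absurd (by linear_combination (p : R) * h5 + hpe) hp0
  exact exists_natCast_mul_eq_of_isNilpotent hp hp2 hk hs2 hps hsp n y hy
    (pow_eq_zero_of_le (Nat.lt_pow_self hp.one_lt).le hyn)

/-! ### Characteristic a power of two -/

/-- As `-1` squares to `1`, `-2` is a multiple of `2 ^ (k + 1)`; now double. -/
theorem four_eq_zero_of_two_pow {k : ℕ} (hk : (2 : R) ^ (k + 1) ≠ 0)
    (hk' : (2 : R) ^ (k + 2) = 0) : (4 : R) = 0 := by
  obtain ⟨c, hc⟩ := exists_natCast_mul_eq_of_one_add_pow Nat.prime_two (y := (-2 : R)) hk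
    (by rw [← pow_mul]; exact pow_eq_zero_of_le (by omega) hk')
    (by rw [Nat.cast_ofNat, ← pow_succ', hk']) (by ring)
  linear_combination -2 * hc - c * hk'

theorem eq_zero_or_two_of_one_add_sq (h4 : (4 : R) = 0) (h2 : (2 : R) ≠ 0) {y : R}
    (hy : (1 + y) ^ 2 = 1) : y = 0 ∨ y = 2 := by
  obtain ⟨c, hc⟩ := exists_natCast_mul_eq_of_one_add_pow Nat.prime_two h2
    (by linear_combination h4) (by push_cast; linear_combination h4) hy
  rcases Nat.even_or_odd' c with ⟨d, rfl | rfl⟩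
  · left; push_cast at hc; linear_combination hc + d * h4
  · right; push_cast at hc; linear_combination hc + d * h4

/-- `1 + 2 * y` squares to `1`, so `2 * y` is `0` or `2`. -/
theorem two_mul_eq_zero_or (h4 : (4 : R) = 0) (h2 : (2 : R) ≠ 0) (y : R) :
    2 * y = 0 ∨ 2 * (1 + y) = 0 := by
  rcases eq_zero_or_two_of_one_add_sq h4 h2 (y := 2 * y)
    (by linear_combination (y + y ^ 2) * h4) with h | h
  · exact Or.inl h
  · right; linear_combination h + h4

/-- The annihilator `M` of `2` and its translate `1 + M` split the ring into halves. No unit lies in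
`M`, so by counting the units fill `1 + M`. -/
theorem isUnit_one_add_of_two_mul_eq_zero (h4 : (4 : R) = 0) (h2 : (2 : R) ≠ 0)
    (hcard : Nat.card R ≤ 2 * Nat.card Rˣ) {y : R} (hy : 2 * y = 0) : IsUnit (1 + y) := by
  let M : Set R := {y | 2 * y = 0}
  let N : Set R := (fun y => 1 + y) '' M
  let U : Set R := Set.range (Units.val : Rˣ → R)
  have hMN : M ∪ N = Set.univ := by
    ext r
    simp only [Set.mem_union, Set.mem_univ, iff_true]
    rcases two_mul_eq_zero_or h4 h2 r with h | h
    · exact Or.inl h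
    · exact Or.inr ⟨r - 1, show 2 * (r - 1) = 0 by linear_combination h - h4, by ring⟩
  have hdisj : Disjoint M N := by
    rw [Set.disjoint_left]
    rintro _ hm ⟨y, hy, rfl⟩
    have hm' : 2 * (1 + y) = 0 := hm
    have hy' : 2 * y = 0 := hy
    exact h2 (by linear_combination hm' - hy')
  have hNM : N.ncard = M.ncard := Set.ncard_image_of_injective _ (add_right_injective 1)
  have hR : Nat.card R = M.ncard + N.ncard := by
    rw [← Set.ncard_union_eq hdisj, hMN, Set.ncard_univ]
  have hU : U.ncard = Nat.card Rˣ := by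
    rw [show U = Units.val '' (Set.univ : Set Rˣ) from Set.image_univ.symm,
      Set.ncard_image_of_injective _ Units.val_injective, Set.ncard_univ]
  have hUN : U ⊆ N := by
    rintro _ ⟨u, rfl⟩
    have : (u : R) ∈ M ∪ N := hMN ▸ Set.mem_univ _
    refine this.resolve_left fun hu => h2 ?_
    have hu' : 2 * (u : R) = 0 := hu
    exact (Units.mul_left_eq_zero u).1 hu'
  have hUN' : U = N := Set.eq_of_subset_of_ncard_le hUN (by omega)
  have : 1 + y ∈ U := hUN' ▸ ⟨y, hy, rfl⟩
  obtain ⟨u, hu⟩ := this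
  exact ⟨u, hu⟩

/-- Both `1 + z ^ 4` and, if `z ^ 4 = 2`, also `1 + z ^ 3` square to `1`. Then `z ^ 3` is `0` or
`2`, and multiplying by `z` yields `2 = 0`. -/
theorem pow_four_eq_zero_of_pow_eight (h4 : (4 : R) = 0) (h2 : (2 : R) ≠ 0) {z : R}
    (hz : 2 * z = 0) (h8 : z ^ 8 = 0) : z ^ 4 = 0 := by
  have hz4 := eq_zero_or_two_of_one_add_sq h4 h2 (y := z ^ 4)
    (by linear_combination z ^ 3 * hz + h8)
  refine hz4.resolve_right fun hz4 => h2 ?_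
  have hz5 : z ^ 5 = 0 := by linear_combination z * hz4 + hz
  rcases eq_zero_or_two_of_one_add_sq h4 h2 (y := z ^ 3)
    (by linear_combination z ^ 2 * hz + z * hz5) with h | h
  · linear_combination -hz4 + z * h
  · linear_combination -hz4 + z * h + hz

theorem pow_four_eq_zero (h4 : (4 : R) = 0) (h2 : (2 : R) ≠ 0)
    (hcard : Nat.card R ≤ 2 * Nat.card Rˣ) {y : R} (hy : 2 * y = 0) : y ^ 4 = 0 := by
  obtain ⟨n, hn, he⟩ := exists_pow_mul_self_eq y
  have h2e : 2 * y ^ n = 0 := by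
    rw [← Nat.sub_add_cancel hn, pow_succ', ← mul_assoc, hy, zero_mul]
  -- The unit `1 + y ^ n` kills the idempotent `y ^ n`, as `2 * y ^ n = 0`.
  have hyn : y ^ n = 0 :=
    (isUnit_one_add_of_two_mul_eq_zero h4 h2 hcard h2e).mul_right_eq_zero.1
      (by linear_combination he + h2e)
  have hdesc : ∀ m : ℕ, y ^ 2 ^ (m + 2) = 0 → y ^ 4 = 0 := by
    intro m
    induction m with
    | zero => intro h; simpa using h
    | succ m ih =>
      intro h
      refine ih ?_
      have h8 : (y ^ 2 ^ m) ^ 8 = 0 := by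
        rw [← pow_mul, ← h]; congr 1; ring
      have hm : 2 * y ^ 2 ^ m = 0 := by
        rw [← Nat.sub_add_cancel (Nat.one_le_two_pow (n := m)), pow_succ', ← mul_assoc, hy,
          zero_mul]
      have := pow_four_eq_zero_of_pow_eight h4 h2 hm h8
      rw [← pow_mul] at this
      rw [← this]; congr 1; ring
  refine hdesc n (pow_eq_zero_of_le ?_ hyn)
  exact (Nat.lt_two_pow_self.trans (Nat.pow_lt_pow_right one_lt_two (by omega))).le

/-- A generator `g` has `2 * (g - 1) = 0`, hence `(g - 1) ^ 4 = 0`, which expands to `g ^ 4 = 1`: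
there are at most 4 units. -/
theorem card_le_eight (h4 : (4 : R) = 0) (h2 : (2 : R) ≠ 0)
    (hcard : Nat.card R ≤ 2 * Nat.card Rˣ) : Nat.card R ≤ 8 := by
  obtain ⟨g, hg⟩ := IsCyclic.exists_ofOrder_eq_natCard (α := Rˣ)
  have hg4 : g ^ 4 = 1 := by
    apply Units.ext
    have hM : 2 * ((g : R) - 1) = 0 := by
      rcases two_mul_eq_zero_or h4 h2 (g : R) with h | h
      · exact absurd ((Units.mul_left_eq_zero g).1 h) h2
      · linear_combination h - h4
    have h := pow_four_eq_zero h4 h2 hcard hM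
    rw [Units.val_pow_eq_pow_val, Units.val_one]
    linear_combination h + ((g : R) ^ 3 - 2 * (g : R) ^ 2 + g) * h4 + ((g : R) + 1) * hM
  have := Nat.le_of_dvd (by norm_num) (orderOf_dvd_of_pow_eq_one hg4)
  omega

theorem exists_two_mul_eq_zero_of_not_cyclic (h4 : (4 : R) = 0) (h2 : (2 : R) ≠ 0) {r : R}
    (hr : ∀ z : ℤ, r ≠ z) : ∃ y : R, 2 * y = 0 ∧ y ≠ 0 ∧ y ≠ 2 := by
  rcases two_mul_eq_zero_or h4 h2 r with h | h
  · exact ⟨r, h, by simpa using hr 0, by simpa using hr 2⟩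
  · exact ⟨1 + r, h, fun h0 => hr (-1) (by push_cast; linear_combination h0),
      fun h0 => hr 1 (by push_cast; linear_combination h0)⟩

theorem nonempty_addEquiv_zmod_two_prod_four {R : Type*} [CommRing R] [Finite R]
    (h4 : (4 : R) = 0) (h2 : (2 : R) ≠ 0)   (hcard : Nat.card R ≤ 8) {y : R} (hy : 2 * y = 0) (hy0 : y ≠ 0) (hy2 : y ≠ 2) :
    Nonempty (ZMod 2 × ZMod 4 ≃+ R) := by
  let f₁ : ZMod 2 →+ R := ZMod.lift 2 ⟨zmultiplesHom R y, by simpa using hy⟩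
  let f₂ : ZMod 4 →+ R := ZMod.lift 4 ⟨zmultiplesHom R 1, by simpa using h4⟩
  have hf : Function.Injective (f₁.coprod f₂) := by
    rw [injective_iff_map_eq_zero]
    rintro ⟨a, b⟩ h
    obtain ⟨m, rfl⟩ := ZMod.intCast_surjective a
    obtain ⟨n, rfl⟩ := ZMod.intCast_surjective b
    have h : (m : R) * y + n = 0 := by simpa [f₁, f₂] using h
    -- If `n` is odd, doubling the relation gives `2 = 0`; if only `m` is odd, `y` is `0` or `2`.
    obtain ⟨d, rfl | rfl⟩ := Int.even_or_odd' m <;> obtain ⟨e, rfl | rfl⟩ := Int.even_or_odd' n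
    · obtain ⟨c, rfl | rfl⟩ := Int.even_or_odd' e
      · refine Prod.ext ?_ ?_
        · exact (ZMod.intCast_zmod_eq_zero_iff_dvd _ 2).2 ⟨d, by push_cast; ring⟩
        · exact (ZMod.intCast_zmod_eq_zero_iff_dvd _ 4).2 ⟨c, by push_cast; ring⟩
      · push_cast at h
        exact absurd (by linear_combination h - d * hy - c * h4) h2
    · push_cast at h
      exact absurd (by linear_combination 2 * h - 2 * d * hy - e * h4) h2
    · obtain ⟨c, rfl | rfl⟩ := Int.even_or_odd' e <;> push_cast at h
      · exact absurd (by linear_combination h - d * hy - c * h4) hy0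
      · exact absurd (by linear_combination h - d * hy - (c + 1) * h4) hy2
    · push_cast at h
      exact absurd (by linear_combination 2 * h - (2 * d + 1) * hy - e * h4) h2
  refine ⟨AddEquiv.ofBijective _ ((Nat.bijective_iff_injective_and_card _).2 ⟨hf, ?_⟩)⟩
  refine le_antisymm (Nat.card_le_card_of_injective _ hf) (hcard.trans ?_)
  simp

/-- A finite commutative ring of `p`-power characteristic whose unit group is cyclic and contains
at least half of the elements has one of three additive groups. -/
theorem additive_structure_of_isCyclic_units {p n : ℕ} (hp : p.Prime) (hn : (p : R) ^ n = 0)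
    (hcard : Nat.card R ≤ 2 * Nat.card Rˣ) :
    (p : R) = 0 ∨ (∀ r : R, ∃ z : ℤ, r = z) ∨ Nonempty (ZMod 2 × ZMod 4 ≃+ R) := by
  classical
  by_cases hp0 : (p : R) = 0
  · exact Or.inl hp0
  right
  have hex : ∃ n, (p : R) ^ n = 0 := ⟨n, hn⟩
  -- The exponent is at least 2, so that `p ^ (k + 1)` has square zero.
  obtain ⟨k, hk⟩ : ∃ k, Nat.find hex = k + 2 := by
    refine Nat.exists_eq_add_of_le' ?_
    by_contra hlt
    have hpow := Nat.find_spec hex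
    have hle : Nat.find hex ≤ 1 := by omega
    exact hp0 (by simpa using pow_eq_zero_of_le hle hpow)
  have hk0 : (p : R) ^ (k + 1) ≠ 0 := Nat.find_min hex (by omega)
  have hk1 : (p : R) ^ (k + 2) = 0 := hk ▸ Nat.find_spec hex
  by_cases hp2 : p = 2
  · subst hp2
    push_cast at hk0 hk1 hp0
    have h4 := four_eq_zero_of_two_pow hk0 hk1
    by_cases hcyc : ∀ r : R, ∃ z : ℤ, r = z
    · exact Or.inl hcyc
    push Not at hcyc
    obtain ⟨r, hr⟩ := hcyc
    obtain ⟨y, hy, hy0, hy2⟩ := exists_two_mul_eq_zero_of_not_cyclic h4 hp0 hr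
    exact Or.inr (nonempty_addEquiv_zmod_two_prod_four h4 hp0 (card_le_eight h4 hp0 hcard)
      hy hy0 hy2)
  · exact Or.inl (exists_intCast_eq_of_odd hp hp2 hk0 hk1)

end CyclicUnits

/-! ### From a large cycle to a ring -/

/-- If an automorphism of a finite abelian group has an orbit, not that of `0`, containing at least
half of the elements, then the group is the additive group of a finite commutative ring with cyclic
unit group which contains at least half of the ring. -/
theorem exists_commRing_of_large_cycle.{u} {A : Type u} [AddCommGroup A] [Finite A]
    (τ : AddMonoid.End A) {N : ℕ} (hN : 0 < N) (hτ : τ ^ N = 1) {x : A} (hx : x ≠ 0) {O : Set A}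
    (hO : ∀ y ∈ O, ∃ i : ℕ, y = (τ ^ i) x) (hcard : Nat.card A ≤ 2 * O.ncard) :
    ∃ (R : Type u) (_ : CommRing R) (_ : Finite R), IsCyclic Rˣ ∧
      Nat.card R ≤ 2 * Nat.card Rˣ ∧ Nonempty (R ≃+ A) := by
  have : Finite (AddMonoid.End A) := Finite.of_injective (fun α : AddMonoid.End A => (α : A → A))
    DFunLike.coe_injective
  let S := Algebra.adjoin ℤ ({τ} : Set (AddMonoid.End A))
  have : IsMulCommutative S := Algebra.isMulCommutative_adjoin ℤ (by
    rintro a rfl b rfl; rfl)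
  let t : S := ⟨τ, Algebra.self_mem_adjoin_singleton ℤ τ⟩
  have ht : t ^ N = 1 := Subtype.ext hτ
  let u : Sˣ := Units.ofPowEqOne t N ht hN.ne'
  let φ : S →+ A := (AddMonoidHom.eval x).comp S.val.toAddMonoidHom
  have hφ : ∀ s : S, φ s = (s : AddMonoid.End A) x := fun s => rfl
  have hOφ : O ⊆ (fun v : Sˣ => φ v) '' (Subgroup.zpowers u : Set Sˣ) := by
    intro y hy
    obtain ⟨i, rfl⟩ := hO y hy
    exact ⟨u ^ i, Subgroup.npow_mem_zpowers u i, rfl⟩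
  have hOu : O.ncard ≤ Nat.card (Subgroup.zpowers u) :=
    (Set.ncard_le_ncard hOφ).trans (Set.ncard_image_le)
  have hO0 : (0 : A) ∉ O := by
    intro h
    obtain ⟨i, hi⟩ := hO 0 h
    have hinv : τ ^ (i * (N - 1)) * τ ^ i = 1 := by
      rw [← pow_add, ← Nat.mul_add_one, Nat.sub_add_cancel hN, mul_comm, pow_mul, hτ, one_pow]
    have h1 : (τ ^ (i * (N - 1))) ((τ ^ i) x) = x := DFunLike.congr_fun hinv x
    exact hx (h1.symm.trans ((congrArg (τ ^ (i * (N - 1))) hi.symm).trans (map_zero _)))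
  -- The image contains `O` and also `0 ∉ O`: more than half of `A`, so its index is 1.
  have hsurj : Function.Surjective φ := by
    rw [← AddMonoidHom.range_eq_top]
    have hins : insert 0 O ⊆ (φ.range : Set A) := by
      rw [Set.insert_subset_iff]
      refine ⟨φ.range.zero_mem, fun y hy => ?_⟩
      obtain ⟨v, -, rfl⟩ := hOφ hy
      exact ⟨v, rfl⟩
    have hle := Set.ncard_le_ncard hins
    rw [Set.ncard_insert_of_notMem hO0] at hle
    have hc : (φ.range : Set A).ncard = Nat.card φ.range := rfl
    obtain ⟨d, hd⟩ := φ.range.card_addSubgroup_dvd_card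
    refine AddSubgroup.eq_top_of_card_eq _ ?_
    have : 0 < Nat.card A := Nat.card_pos
    have hd1 : d < 2 := by
      by_contra hd2
      nlinarith
    interval_cases d <;> omega
  -- If `s` kills `x`, it commutes past every `s'` and kills all `s' x`, that is, all of `A`.
  have hinj : Function.Injective φ := by
    rw [injective_iff_map_eq_zero]
    intro s hs
    apply Subtype.ext
    apply AddMonoidHom.ext
    intro a
    obtain ⟨s', rfl⟩ := hsurj a
    have h : (s * s' : S) = s' * s := mul_comm _ _
    have h' : (s : AddMonoid.End A) ((s' : AddMonoid.End A) x) =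
        (s' : AddMonoid.End A) ((s : AddMonoid.End A) x) :=
      DFunLike.congr_fun (congrArg Subtype.val h) x
    exact h'.trans ((congrArg (s' : AddMonoid.End A) hs).trans (map_zero _))
  let e : S ≃+ A := AddEquiv.ofBijective φ ⟨hinj, hsurj⟩
  have : Nontrivial A := ⟨x, 0, hx⟩
  have : Nontrivial S := e.toEquiv.nontrivial
  have hSA : Nat.card S = Nat.card A := Nat.card_congr e.toEquiv
  have hlt : Nat.card Sˣ < Nat.card S := by
    have h0 : (0 : S) ∉ Set.range (Units.val : Sˣ → S) := by
      rintro ⟨v, hv⟩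
      exact v.ne_zero hv
    have h1 : (Set.range (Units.val : Sˣ → S)).ncard = Nat.card Sˣ := by
      rw [← Set.image_univ, Set.ncard_image_of_injective _ Units.val_injective, Set.ncard_univ]
    rw [← h1, ← Set.ncard_univ]
    exact Set.ncard_lt_ncard (Set.ssubset_univ_iff.2 fun h => h0 (h ▸ Set.mem_univ _))
  have hle : Nat.card (Subgroup.zpowers u) ≤ Nat.card Sˣ := Subgroup.card_le_card_group _
  -- As `0` is not a unit, the powers of `u` form more than half of the units.
  have htop : Subgroup.zpowers u = ⊤ := by
    obtain ⟨d, hd⟩ := (Subgroup.zpowers u).card_subgroup_dvd_card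
    refine Subgroup.eq_top_of_card_eq _ ?_
    have : 0 < Nat.card Sˣ := Nat.card_pos
    have hd1 : d < 2 := by
      by_contra hd2
      nlinarith
    interval_cases d <;> omega
  exact ⟨S, inferInstance, inferInstance, ⟨u, fun v => (Subgroup.eq_top_iff' _).1 htop v⟩, by omega, ⟨e⟩⟩

/-! ### Translation back to groups -/

theorem isElemAbelian_of_pow_eq_one {p : ℕ} (hp : p.Prime) {G : Type*} [CommGroup G] [Finite G]
    (h : ∀ g : G, g ^ p = 1) : IsElemAbelian p G := by
  have := Fact.mk hp
  let : Module (ZMod p) (Additive G) := AddCommGroup.zmodModule (n := p) h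
  exact ⟨_, ⟨AddEquiv.toMultiplicativeRight
    (Module.finBasis (ZMod p) (Additive G)).equivFun.toAddEquiv⟩⟩

/-- An automorphism attaining `λ(G)`, with a point on a longest cycle. -/
theorem exists_mulAut_card_le_two_mul_cycleLength {G : Type*} [Group G] [Finite G]
    (h : 1 / 2 ≤ lambdaGroup G) :
    ∃ (α : MulAut G) (x : G), Nat.card G ≤ 2 * cycleLength (MulAut.toPerm G α) x := by
  obtain ⟨α, hα⟩ := (bigLambdaGroup_isGreatest G).1
  obtain ⟨x, hx⟩ := (bigLambdaPerm_isGreatest (MulAut.toPerm G α)).1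
  refine ⟨α, x, ?_⟩
  have hpos : (0 : ℚ) < Nat.card G := by exact_mod_cast Nat.card_pos
  rw [hx, show bigLambdaPerm (MulAut.toPerm G α) = bigLambdaGroup G from hα]
  rw [lambdaGroup, le_div_iff₀ hpos] at h
  have : (Nat.card G : ℚ) ≤ 2 * bigLambdaGroup G := by linarith
  exact_mod_cast this

theorem mainTheorem6 (p : ℕ) (hp : p.Prime) (G : Type*) [CommGroup G] [Finite G]
    (hG : IsPGroup p G) (hlam : 1 / 2 ≤ lambdaGroup G) :
    IsElemAbelian p G ∨ IsCyclic G ∨ Nonempty (G ≃* Multiplicative (ZMod 2 × ZMod 4)) := by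
  obtain ⟨α, x, hx⟩ := exists_mulAut_card_le_two_mul_cycleLength hlam
  have hcyc : ∀ y, (MulAut.toPerm G α).SameCycle x y → ∃ i : ℕ, y = (α ^ i) x := by
    intro y hy
    obtain ⟨i, -, hi⟩ := hy.exists_pow_eq'
    refine ⟨i, ?_⟩
    rw [← hi, ← map_pow]
    rfl
  -- The identity is fixed, so in this case the group has order at most 2.
  by_cases hx1 : x = 1
  · right; left
    subst hx1
    have hle : cycleLength (MulAut.toPerm G α) 1 ≤ 1 := by
      rw [cycleLength, ← Set.ncard_singleton (1 : G)]
      refine Set.ncard_le_ncard fun y hy => ?_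
      obtain ⟨i, rfl⟩ := hcyc y hy
      exact map_one _
    have hcard : Nat.card G ∣ 2 := by
      have : 0 < Nat.card G := Nat.card_pos
      have : Nat.card G ≤ 2 := by omega
      interval_cases Nat.card G <;> norm_num
    exact isCyclic_of_card_dvd_prime hcard
  have : Finite (MulAut G) := Finite.of_injective (fun β : MulAut G => (β : G → G))
    DFunLike.coe_injective
  let τ : AddMonoid.End (Additive G) := MonoidHom.toAdditive α.toMonoidHom
  have hτ : ∀ (i : ℕ) (g : G), (τ ^ i) (Additive.ofMul g) = Additive.ofMul ((α ^ i) g) := by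
    intro i
    induction i with
    | zero => intro g; rfl
    | succ i ih => intro g; rw [pow_succ, pow_succ]; exact ih _
  have hτ1 : τ ^ orderOf α = 1 := by
    apply AddMonoidHom.ext
    intro g
    refine (hτ _ g.toMul).trans ?_
    rw [pow_orderOf_eq_one]
    rfl
  obtain ⟨R, _, _, _, hcard, ⟨e⟩⟩ := exists_commRing_of_large_cycle τ (orderOf_pos α) hτ1
    (x := Additive.ofMul x) hx1 (O := {y | (MulAut.toPerm G α).SameCycle x y.toMul})
    (fun y hy => by
      obtain ⟨i, hi⟩ := hcyc _ hy
      exact ⟨i, (congrArg Additive.ofMul hi).trans (hτ i x).symm⟩) hx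
  have := Fact.mk hp
  obtain ⟨n, hn⟩ := IsPGroup.iff_card.1 hG
  have hpn : (p : R) ^ n = 0 := by
    have h : Nat.card R = p ^ n := (Nat.card_congr e.toEquiv).trans hn
    rw [← Nat.cast_pow, ← h, ← nsmul_one, card_nsmul_eq_zero']
  rcases additive_structure_of_isCyclic_units hp hpn hcard with h | h | ⟨⟨f⟩⟩
  · refine Or.inl (isElemAbelian_of_pow_eq_one hp fun g => ?_)
    have hg : p • (Additive.ofMul g) = 0 := by
      rw [← e.apply_symm_apply (Additive.ofMul g), ← map_nsmul, nsmul_eq_mul, h, zero_mul,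
        map_zero]
    exact hg
  · refine Or.inr (Or.inl ⟨(e 1).toMul, fun g => ?_⟩)
    obtain ⟨z, hz⟩ := h (e.symm (Additive.ofMul g))
    refine ⟨z, ?_⟩
    have hg : z • e 1 = Additive.ofMul g := by
      rw [← map_zsmul, zsmul_one, ← hz, e.apply_symm_apply]
    exact hg
  · exact Or.inr (Or.inr ⟨AddEquiv.toMultiplicativeRight (f.trans e).symm⟩)
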